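/- Let $\mathcal I$ be a finite table (set of cells) and let $\mathbf A=(a_{ji})$ be the $0$-$1$ matrix whose rows $A_1,\dots,A_J$ ($J\ge 1$) are the indicators of non-empty subsets $S_1,\dots,S_J$ of $\mathcal I$. The cell parameters $\boldsymbol\delta=(\delta(i))_{i\in\mathcal I}$ are either intensities, $\boldsymbol\delta\equiv\boldsymbol\lambda$ with $\lambda(i)>0$, the observed counts $\boldsymbol y\in\mathbb Z_{\ge0}^{\mathcal I}$ being independent Poisson; or probabilities, $\boldsymbol\delta\equiv\boldsymbol p$ with $p(i)>0$ and $\sum_i p(i)=1$, the counts $\boldsymbol y$ being multinomial with $N=\sum_i y(i)\ge 1$. The relational model generated by $\mathbf A$ consists of those $\boldsymbol\delta$ with $\log\boldsymbol\delta=\mathbf A'\boldsymbol\beta$ for some $\boldsymbol\beta\in\mathbb R^J$; the vector $\boldsymbol 1$ may or may not lie in the row space of $\mathbf A$ (overall effect present or absent). An MLE is a maximizer of the likelihood of $\boldsymbol y$ over the model. Put $\boldsymbol q=\boldsymbol y$ for intensities and $\boldsymbol q=\boldsymbol y/N$ for probabilities, and write $\boldsymbol 1\boldsymbol v$ for the sum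 of the components of $\boldsymbol v$. IPF($\gamma$): start from $\delta^{(0)}_\gamma(i)=1$ for all $i$, and for $d=0,1,2,\dots$, with $j\in\{1,\dots,J\}$, $j\equiv d+1 \bmod J$, put $$\delta_\gamma^{(d+1)}(i)=\delta_\gamma^{(d)}(i)\left(\gamma\,\frac{A_j\boldsymbol q}{A_j\boldsymbol\delta_\gamma^{(d)}}\right)^{a_{ji}},\qquad i\in\mathcal I .$$ The procedure halts as soon as $\mathbf A\boldsymbol\delta_\gamma^{(d+1)}=\gamma\mathbf A\boldsymbol q$, with output $\boldsymbol\delta^*_\gamma=\boldsymbol\delta_\gamma^{(d+1)}$; if it never halts, its output is $\boldsymbol\delta^*_\gamma=\lim_{d\to\infty}\boldsymbol\delta^{(d)}_\gamma$ (if this limit exists). G-IPF (in exact arithmetic): for intensities, the output is that of IPF($1$). For probabilities, compute the output $\boldsymbol p^*$ of IPF($1$); if $\boldsymbol 1\boldsymbol p^*=1$, the output is $\boldsymbol p^*$. Otherwise start with $\gamma_L=(\boldsymbol 1\mathbf A\boldsymbol q)^{-1}$ and $\gamma_R=\min_j 1/(A_j\boldsymbol q)$, and repeat: compute $\boldsymbol\delta^*_m$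 for $m=(\gamma_L+\gamma_R)/2$ with IPF($m$); if $\boldsymbol 1\boldsymbol\delta^*_m=1$, halt with output $\boldsymbol\delta^*_m$; if $\boldsymbol 1\boldsymbol\delta^*_m<1$, replace $\gamma_L$ by $m$; else replace $\gamma_R$ by $m$. If this bisection never halts, the output is the limit of the successive vectors $\boldsymbol\delta^*_m$ (if it exists). Theorem. Assume that the maximum likelihood estimate of $\boldsymbol\delta$ under the relational model generated by $\mathbf A$ exists and is unique. Then the output of G-IPF exists (in particular, every call of IPF made by the algorithm has an output, and all the limits that occur exist), it is unique, and it is the maximum likelihood estimate of $\boldsymbol\delta$. This holds for intensities and for probabilities, with or without the overall effect. -/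

import Mathlib

open Filter Topology
open scoped Matrix

noncomputable section

namespace RelationalModel

/-- The two sampling schemes: independent Poisson counts (the cell parameters are intensities)
and multinomial counts (the cell parameters are probabilities). -/
inductive Sampling
  | poisson
  | multinomial

variable {I : Type*} [Fintype I] [DecidableEq I] {J : ℕ}

/-- The model matrix: its rows are the indicators of the generating subsets. -/
def modelMatrix (S : Fin J → Finset I) : Matrix (Fin J) I ℝ :=
  Matrix.of fun j i => if i ∈ S j then 1 else 0

/-- The admissible cell parameters: positive vectors, with total one for probabilities. -/
def parameterSpace (I : Type*) [Fintype I] : Sampling → Set (I → ℝ)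
  | .poisson => {δ | ∀ i, 0 < δ i}
  | .multinomial => {δ | (∀ i, 0 < δ i) ∧ ∑ i, δ i = 1}

/-- The relational model with model matrix `A`: the admissible `δ` with `log δ = A' β`
for some `β`. -/
def relationalModel (s : Sampling) (A : Matrix (Fin J) I ℝ) : Set (I → ℝ) :=
  {δ | δ ∈ parameterSpace I s ∧ ∃ β : Fin J → ℝ, ∀ i, Real.log (δ i) = (Aᵀ *ᵥ β) i}

/-- The likelihood of the cell parameters, i.e. the probability of observing the counts `y`. -/
def likelihood (s : Sampling) (y : I → ℕ) (δ : I → ℝ) : ℝ :=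
  match s with
  | .poisson => ∏ i, (Real.exp (-δ i) * δ i ^ y i / ((y i).factorial : ℝ))
  | .multinomial => (Nat.multinomial Finset.univ y : ℝ) * ∏ i, δ i ^ y i

/-- `δ` is a maximum likelihood estimate of the cell parameters under the relational model
with model matrix `A`. -/
def IsMLE (s : Sampling) (A : Matrix (Fin J) I ℝ) (y : I → ℕ) (δ : I → ℝ) : Prop :=
  δ ∈ relationalModel s A ∧ IsMaxOn (likelihood s y) (relationalModel s A) δ

/-- The vector `q`: observed counts for intensities, observed relative frequencies for
probabilities. -/
def observed (s : Sampling) (y : I → ℕ) (i : I) : ℝ :=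
  match s with
  | .poisson => (y i : ℝ)
  | .multinomial => (y i : ℝ) / ∑ k, (y k : ℝ)

/-- The output of an idealized (exact arithmetic) iterative procedure with successive values
`x 0, x 1, …` and halting test `halt`: the value at the first index that passes the test or,
if no index does, the limit of the values. -/
def IterationOutput (x : ℕ → I → ℝ) (halt : ℕ → Prop) (out : I → ℝ) : Prop :=
  (∃ d, halt d ∧ (∀ e < d, ¬ halt e) ∧ out = x d) ∨
    ((∀ d, ¬ halt d) ∧ Tendsto x atTop (𝓝 out))

/-- The vectors `δ^(d)` of IPF(γ). The `J` subset sums are treated cyclically: with the rows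
numbered from `0`, step `d` treats row `d mod J`. -/
def ipfSeq [NeZero J] (A : Matrix (Fin J) I ℝ) (q : I → ℝ) (γ : ℝ) : ℕ → I → ℝ
  | 0 => fun _ => 1
  | d + 1 => fun i =>
      ipfSeq A q γ d i *
        (γ * ((A *ᵥ q) (Fin.ofNat J d) / (A *ᵥ ipfSeq A q γ d) (Fin.ofNat J d))) ^
          A (Fin.ofNat J d) i

/-- `δ` is the output of IPF(γ); after every update it is tested whether all subset sums
are as desired. -/
def IPFOutput [NeZero J] (A : Matrix (Fin J) I ℝ) (q : I → ℝ) (γ : ℝ) (δ : I → ℝ) : Prop :=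
  IterationOutput (fun d => ipfSeq A q γ (d + 1))
    (fun d => ∀ j, γ * (A *ᵥ q) j = (A *ᵥ ipfSeq A q γ (d + 1)) j) δ

/-- Left end of the initial bisection interval, `(1 A q)⁻¹`. -/
def gammaLeft (A : Matrix (Fin J) I ℝ) (q : I → ℝ) : ℝ := (∑ j, (A *ᵥ q) j)⁻¹

/-- Right end of the initial bisection interval, `min_j 1 / (A_j q)`. -/
def gammaRight [NeZero J] (A : Matrix (Fin J) I ℝ) (q : I → ℝ) : ℝ :=
  Finset.univ.inf' Finset.univ_nonempty fun j => 1 / (A *ᵥ q) j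

/-- A run of the bisection: `γL k`, `γR k` are the current interval ends, `δ k` is the output of
IPF at the midpoint. As long as the total of `δ k` is not one, the midpoint replaces the left end
if the total is less than one and the right end otherwise. (Entries after the first `k` with
total one are irrelevant and unconstrained.) -/
structure IsBisectionRun [NeZero J] (A : Matrix (Fin J) I ℝ) (q : I → ℝ)
    (γL γR : ℕ → ℝ) (δ : ℕ → I → ℝ) : Prop where
  left_zero : γL 0 = gammaLeft A q
  right_zero : γR 0 = gammaRight A q
  ipf : ∀ k, (∀ e < k, ∑ i, δ e i ≠ 1) → IPFOutput A q ((γL k + γR k) / 2) (δ k)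
  left_succ : ∀ k, (∀ e ≤ k, ∑ i, δ e i ≠ 1) →
    γL (k + 1) = if ∑ i, δ k i < 1 then (γL k + γR k) / 2 else γL k
  right_succ : ∀ k, (∀ e ≤ k, ∑ i, δ e i ≠ 1) →
    γR (k + 1) = if ∑ i, δ k i < 1 then γR k else (γL k + γR k) / 2

/-- `δ` is the result of the bisection over the adjustment factor. -/
def BisectionOutput [NeZero J] (A : Matrix (Fin J) I ℝ) (q : I → ℝ) (δ : I → ℝ) : Prop :=
  ∃ (γL γR : ℕ → ℝ) (x : ℕ → I → ℝ), IsBisectionRun A q γL γR x ∧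
    IterationOutput x (fun k => ∑ i, x k i = 1) δ

/-- `δ` is the output of G-IPF. For intensities this is the output of IPF(1). For probabilities
it is the output `p` of IPF(1) if `p` has total one, and otherwise the result of the bisection. -/
def GIPFOutput [NeZero J] (s : Sampling) (A : Matrix (Fin J) I ℝ) (q : I → ℝ) (δ : I → ℝ) :
    Prop :=
  match s with
  | .poisson => IPFOutput A q 1 δ
  | .multinomial => ∃ p, IPFOutput A q 1 p ∧
      ((∑ i, p i = 1 ∧ δ = p) ∨ (∑ i, p i ≠ 1 ∧ BisectionOutput A q δ))

end RelationalModel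

end

/-!
Write `D(p, x)` for the Kullback–Leibler divergence of positive vectors. If `x` and `ε` are
log-linear with `A x = γ b` and `A ε = γ' b`, then `log x - log ε` lies in the row space of `A` and
`γ D(ε, x) + γ' D(x, ε) = (γ - γ') (1 x - 1 ε)`. Hence the log-linear fit of `γ b` is unique, its
total is nondecreasing in `γ` and determines it, and it depends continuously on `γ`.

An IPF update is the divergence projection on the vectors with a prescribed subset sum, so the
divergence from any positive `p` with all the prescribed sums decreases by amounts that tend to
zero. The iterates therefore stay in a compact set of positive vectors and their cluster points
have the prescribed sums. Putting such a cluster point in the place of `p` shows that the iterates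
converge, to the log-linear fit of `γ A q`.

By the likelihood equations an MLE is the log-linear fit of `γ A q` for some `γ > 0`: with `γ = 1`
for intensities, and with the `γ` given by the Lagrange multiplier of `1 δ = 1` for probabilities.
The bisection brackets this last `γ`, because totals are monotone in `γ`, and its output is the
MLE, by continuity or, if it halts, because the total one determines the fit.
-/

noncomputable section

namespace RelationalModel

section Divergence

variable {α I : Type*} [Fintype I] {l : Filter α}

/-- The Kullback–Leibler divergence of the Poisson distribution with mean `b` from the one with
mean `c`: the share of a single cell in `divergence`. It is meant for positive arguments. -/
def poissonDivergence (b c : ℝ) : ℝ :=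
  b * (Real.log b - Real.log c) + c - b

lemma sq_sqrt_sub_sqrt_le_poissonDivergence {b c : ℝ} (hb : 0 < b) (hc : 0 < c) :
    (√b - √c) ^ 2 ≤ poissonDivergence b c := by
  have hlog : Real.log c - Real.log b ≤ 2 * (√c / √b - 1) := by
    have h := Real.log_le_sub_one_of_pos (div_pos (Real.sqrt_pos.2 hc) (Real.sqrt_pos.2 hb))
    rw [Real.log_div (Real.sqrt_pos.2 hc).ne' (Real.sqrt_pos.2 hb).ne', Real.log_sqrt hc.le,
      Real.log_sqrt hb.le] at h
    linarith
  have hmul : b * (√c / √b) = √b * √c := by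
    rw [mul_div_left_comm, Real.div_sqrt, mul_comm]
  have := mul_le_mul_of_nonneg_left hlog hb.le
  rw [poissonDivergence]
  linarith [sub_sq √b √c, Real.sq_sqrt hb.le, Real.sq_sqrt hc.le]

lemma poissonDivergence_nonneg {b c : ℝ} (hb : 0 < b) (hc : 0 < c) :
    0 ≤ poissonDivergence b c :=
  (sq_nonneg _).trans (sq_sqrt_sub_sqrt_le_poissonDivergence hb hc)

lemma le_two_mul_add_poissonDivergence {b c : ℝ} (hb : 0 < b) (hc : 0 < c) :
    c ≤ 2 * b + 2 * poissonDivergence b c := by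
  nlinarith [sq_sqrt_sub_sqrt_le_poissonDivergence hb hc, Real.sq_sqrt hb.le, Real.sq_sqrt hc.le,
    sq_nonneg (2 * √b - √c)]

lemma sq_sub_le_poissonDivergence {b c : ℝ} (hb : 0 < b) (hc : 0 < c) :
    (b - c) ^ 2 ≤ 2 * (b + c) * poissonDivergence b c :=
  calc (b - c) ^ 2 = (√b ^ 2 - √c ^ 2) ^ 2 := by rw [Real.sq_sqrt hb.le, Real.sq_sqrt hc.le]
    _ = (√b + √c) ^ 2 * (√b - √c) ^ 2 := by ring
    _ ≤ 2 * (√b ^ 2 + √c ^ 2) * (√b - √c) ^ 2 := by gcongr; exact add_sq_le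
    _ ≤ 2 * (b + c) * poissonDivergence b c := by
      rw [Real.sq_sqrt hb.le, Real.sq_sqrt hc.le]
      gcongr
      exact sq_sqrt_sub_sqrt_le_poissonDivergence hb hc

lemma tendsto_sub_of_tendsto_poissonDivergence {b c : α → ℝ} {B : ℝ} (hb : ∀ a, 0 < b a)
    (hbB : ∀ a, b a ≤ B) (hc : ∀ a, 0 < c a)
    (h : Tendsto (fun a => poissonDivergence (b a) (c a)) l (𝓝 0)) :
    Tendsto (fun a => c a - b a) l (𝓝 0) := by
  have hbound : Tendsto (fun a => 2 * (3 * B + 2 * poissonDivergence (b a) (c a)) *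
      poissonDivergence (b a) (c a)) l (𝓝 0) := by
    simpa using (((h.const_mul 2).const_add (3 * B)).const_mul 2).mul h
  have hsq : Tendsto (fun a => (c a - b a) ^ 2) l (𝓝 0) := by
    refine squeeze_zero (fun a => sq_nonneg _) (fun a => ?_) hbound
    rw [sub_sq_comm]
    refine (sq_sub_le_poissonDivergence (hb a) (hc a)).trans ?_
    refine mul_le_mul_of_nonneg_right ?_ (poissonDivergence_nonneg (hb a) (hc a))
    linarith [hbB a, le_two_mul_add_poissonDivergence (hb a) (hc a)]
  rw [tendsto_zero_iff_abs_tendsto_zero]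
  simpa [Function.comp_def, Real.sqrt_sq_eq_abs] using hsq.sqrt

/-- The Kullback–Leibler divergence of `p` from `x`, for positive vectors that need not have
total one. -/
def divergence (p x : I → ℝ) : ℝ :=
  ∑ i, poissonDivergence (p i) (x i)

variable {p x : I → ℝ}

lemma divergence_nonneg (hp : ∀ i, 0 < p i) (hx : ∀ i, 0 < x i) : 0 ≤ divergence p x :=
  Finset.sum_nonneg fun i _ => poissonDivergence_nonneg (hp i) (hx i)

lemma poissonDivergence_le_divergence (hp : ∀ i, 0 < p i) (hx : ∀ i, 0 < x i) (i : I) :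
    poissonDivergence (p i) (x i) ≤ divergence p x :=
  Finset.single_le_sum (f := fun k => poissonDivergence (p k) (x k))
    (fun k _ => poissonDivergence_nonneg (hp k) (hx k)) (Finset.mem_univ i)

lemma sum_le_two_mul_sum_add_divergence (hp : ∀ i, 0 < p i) (hx : ∀ i, 0 < x i) :
    ∑ i, x i ≤ 2 * ∑ i, p i + 2 * divergence p x := by
  rw [divergence, Finset.mul_sum, Finset.mul_sum, ← Finset.sum_add_distrib]
  exact Finset.sum_le_sum fun i _ => le_two_mul_add_poissonDivergence (hp i) (hx i)

lemma eq_of_divergence_eq_zero (hp : ∀ i, 0 < p i) (hx : ∀ i, 0 < x i)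
    (h : divergence p x = 0) : p = x := by
  funext i
  have hi : poissonDivergence (p i) (x i) = 0 :=
    le_antisymm (h ▸ poissonDivergence_le_divergence hp hx i)
      (poissonDivergence_nonneg (hp i) (hx i))
  have hsq := sq_sub_le_poissonDivergence (hp i) (hx i)
  rw [hi, mul_zero] at hsq
  exact sub_eq_zero.1 (pow_eq_zero_iff two_ne_zero |>.1 (le_antisymm hsq (sq_nonneg _)))

lemma mem_Icc_of_divergence_le {K : ℝ} (hp : ∀ i, 0 < p i) (hx : ∀ i, 0 < x i)
    (h : divergence p x ≤ K) :
    x ∈ Set.Icc (fun i => Real.exp (Real.log (p i) - (K + p i) / p i))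
      (fun i => 2 * p i + 2 * K) := by
  have hK := fun i => (poissonDivergence_le_divergence hp hx i).trans h
  refine ⟨fun i => (Real.le_log_iff_exp_le (hx i)).1 ?_, fun i => ?_⟩
  · have hlog : Real.log (p i) - Real.log (x i) ≤ (K + p i) / p i := by
      rw [le_div_iff₀' (hp i)]
      linarith [hK i, hx i, poissonDivergence.eq_1 (p i) (x i)]
    linarith
  · linarith [hK i, le_two_mul_add_poissonDivergence (hp i) (hx i)]

lemma tendsto_of_tendsto_divergence {x : α → I → ℝ} (hp : ∀ i, 0 < p i) (hx : ∀ a i, 0 < x a i)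
    (h : Tendsto (fun a => divergence p (x a)) l (𝓝 0)) : Tendsto x l (𝓝 p) := by
  refine tendsto_pi_nhds.2 fun i => tendsto_sub_nhds_zero_iff.1 ?_
  refine tendsto_sub_of_tendsto_poissonDivergence (fun _ => hp i) (fun _ => le_rfl)
    (fun a => hx a i) ?_
  exact squeeze_zero (fun a => poissonDivergence_nonneg (hp i) (hx a i))
    (fun a => poissonDivergence_le_divergence hp (hx a) i) h

lemma tendsto_divergence {x : α → I → ℝ} (hp : ∀ i, 0 < p i) (h : Tendsto x l (𝓝 p)) :
    Tendsto (fun a => divergence p (x a)) l (𝓝 0) := by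
  have hcont : ContinuousAt (divergence p) p :=
    tendsto_finsetSum _ fun i _ =>
      ((((continuousAt_apply i p).log (hp i).ne').tendsto.const_sub _).const_mul _ |>.add
        (continuousAt_apply i p)).sub_const _
  have hself : divergence p p = 0 := by simp [divergence, poissonDivergence]
  exact hself ▸ hcont.tendsto.comp h

end Divergence

section Fit

variable {α I : Type*} [Fintype I] {J : ℕ} {A : Matrix (Fin J) I ℝ} {b : Fin J → ℝ}
  {γ γ' : ℝ} {x ε : I → ℝ}

/-- `x` is the log-linear fit of the subset sums `b`: a member of the relational model for
intensities with `A x = b`. Apart from the normalization, all estimates and all outputs of IPF are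
fits of multiples of `A q`. -/
structure IsFit (A : Matrix (Fin J) I ℝ) (b : Fin J → ℝ) (x : I → ℝ) : Prop where
  mem : x ∈ relationalModel .poisson A
  mulVec_eq : A *ᵥ x = b

lemma IsFit.pos (h : IsFit A b x) : ∀ i, 0 < x i :=
  h.mem.1

lemma mem_relationalModel_poisson : x ∈ relationalModel .poisson A ↔
    (∀ i, 0 < x i) ∧ (fun i => Real.log (x i)) ∈ LinearMap.range Aᵀ.mulVecLin := by
  simp only [LinearMap.mem_range, Matrix.mulVecLin_apply, funext_iff, eq_comm (b := Real.log _)]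
  rfl

lemma mem_relationalModel_poisson_of_tendsto {l : Filter α} [l.NeBot] {u : α → I → ℝ}
    (hu : ∀ a, u a ∈ relationalModel .poisson A) (hx : ∀ i, 0 < x i) (h : Tendsto u l (𝓝 x)) :
    x ∈ relationalModel .poisson A := by
  refine mem_relationalModel_poisson.2 ⟨hx, ?_⟩
  refine (LinearMap.range Aᵀ.mulVecLin).closed_of_finiteDimensional.mem_of_tendsto
    (tendsto_pi_nhds.2 fun i => (tendsto_pi_nhds.1 h i).log (hx i).ne')
    (Eventually.of_forall fun a => (mem_relationalModel_poisson.1 (hu a)).2)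

lemma exists_sum_mul_log_sub_eq_dotProduct (hx : x ∈ relationalModel .poisson A)
    (hε : ε ∈ relationalModel .poisson A) :
    ∃ β : Fin J → ℝ, ∀ v : I → ℝ,
      ∑ i, v i * (Real.log (x i) - Real.log (ε i)) = β ⬝ᵥ A *ᵥ v := by
  obtain ⟨-, β, hβ⟩ := hx
  obtain ⟨-, β', hβ'⟩ := hε
  refine ⟨β - β', fun v => ?_⟩
  simp only [hβ, hβ', ← Pi.sub_apply, ← Matrix.mulVec_sub]
  rw [Matrix.dotProduct_mulVec, ← Matrix.mulVec_transpose, dotProduct_comm]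
  rfl

/-- The logarithmic terms on the left are `-γ γ' t` and `γ γ' t` for a common `t`, since
`log x - log ε` lies in the row space of `A`. -/
theorem IsFit.divergence_add_divergence (hx : IsFit A (γ • b) x) (hε : IsFit A (γ' • b) ε) :
    γ * divergence ε x + γ' * divergence x ε = (γ - γ') * (∑ i, x i - ∑ i, ε i) := by
  obtain ⟨β, hβ⟩ := exists_sum_mul_log_sub_eq_dotProduct hx.mem hε.mem
  have hx_log : divergence x ε = γ * (β ⬝ᵥ b) + ∑ i, ε i - ∑ i, x i := by
    rw [← smul_eq_mul, ← dotProduct_smul, ← hx.mulVec_eq, ← hβ]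
    simp only [divergence, poissonDivergence, Finset.sum_sub_distrib, Finset.sum_add_distrib]
  have hε_log : divergence ε x = -(γ' * (β ⬝ᵥ b)) + ∑ i, x i - ∑ i, ε i := by
    rw [← smul_eq_mul, ← dotProduct_smul, ← hε.mulVec_eq, ← hβ, ← Finset.sum_neg_distrib]
    simp only [divergence, poissonDivergence, Finset.sum_sub_distrib, Finset.sum_add_distrib,
      ← mul_neg, neg_sub]
  rw [hx_log, hε_log]
  ring

lemma IsFit.le_of_sum_lt_sum (hx : IsFit A (γ • b) x) (hε : IsFit A (γ' • b) ε)
    (hγ : 0 ≤ γ) (hγ' : 0 ≤ γ') (h : ∑ i, x i < ∑ i, ε i) : γ ≤ γ' := by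
  have hprod : 0 ≤ (γ - γ') * (∑ i, x i - ∑ i, ε i) := by
    rw [← hx.divergence_add_divergence hε]
    exact add_nonneg (mul_nonneg hγ (divergence_nonneg hε.pos hx.pos))
      (mul_nonneg hγ' (divergence_nonneg hx.pos hε.pos))
  exact sub_nonpos.1 (nonpos_of_mul_nonneg_left hprod (sub_neg.2 h))

lemma IsFit.mul_divergence_le (hx : IsFit A (γ • b) x) (hε : IsFit A (γ' • b) ε)
    (hγ' : 0 ≤ γ') : γ * divergence ε x ≤ (γ - γ') * (∑ i, x i - ∑ i, ε i) := by
  rw [← hx.divergence_add_divergence hε]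
  exact le_add_of_nonneg_right (mul_nonneg hγ' (divergence_nonneg hx.pos hε.pos))

lemma IsFit.eq_of_mul_sum_sub_sum_nonpos (hx : IsFit A (γ • b) x) (hε : IsFit A (γ' • b) ε)
    (hγ : 0 < γ) (hγ' : 0 ≤ γ') (h : (γ - γ') * (∑ i, x i - ∑ i, ε i) ≤ 0) : x = ε := by
  have hdiv := nonpos_of_mul_nonpos_right ((hx.mul_divergence_le hε hγ').trans h) hγ
  exact (eq_of_divergence_eq_zero hε.pos hx.pos
    (le_antisymm hdiv (divergence_nonneg hε.pos hx.pos))).symm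

theorem IsFit.eq_of_sum_eq (hx : IsFit A (γ • b) x) (hε : IsFit A (γ' • b) ε) (hγ : 0 < γ)
    (hγ' : 0 ≤ γ') (hsum : ∑ i, x i = ∑ i, ε i) : x = ε :=
  hx.eq_of_mul_sum_sub_sum_nonpos hε hγ hγ' (by rw [hsum, sub_self, mul_zero])

theorem IsFit.eq (hx : IsFit A b x) (hε : IsFit A b ε) : x = ε := by
  rw [← one_smul ℝ b] at hx hε
  exact hx.eq_of_mul_sum_sub_sum_nonpos hε one_pos zero_le_one (by rw [sub_self, zero_mul])

theorem IsFit.tendsto {l : Filter α} {g : α → ℝ} {u : α → I → ℝ}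
    (hu : ∀ a, IsFit A (g a • b) (u a)) (hε : IsFit A (γ • b) ε) (hγ : 0 < γ)
    (hg : Tendsto g l (𝓝 γ)) : Tendsto u l (𝓝 ε) := by
  refine tendsto_of_tendsto_divergence hε.pos (fun a => (hu a).pos) ?_
  have hdist : Tendsto (fun a => |g a - γ|) l (𝓝 0) := by
    simpa using (hg.sub_const γ).abs
  have hslope : Tendsto (fun a => g a - 2 * |g a - γ|) l (𝓝 γ) := by
    simpa using hg.sub (hdist.const_mul 2)
  have hbound : Tendsto (fun a => (|g a - γ| * ∑ i, ε i) / (g a - 2 * |g a - γ|)) l (𝓝 0) := by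
    have := (hdist.mul_const (∑ i, ε i)).div hslope hγ.ne'
    rwa [zero_mul, zero_div] at this
  refine squeeze_zero' (Eventually.of_forall fun a => divergence_nonneg hε.pos (hu a).pos) ?_ hbound
  filter_upwards [hslope.eventually_const_lt hγ] with a ha
  have habs : |∑ i, u a i - ∑ i, ε i| ≤ ∑ i, ε i + 2 * divergence ε (u a) := by
    have := sum_le_two_mul_sum_add_divergence hε.pos (hu a).pos
    have := Finset.sum_nonneg fun i (_ : i ∈ Finset.univ) => ((hu a).pos i).le
    have := divergence_nonneg hε.pos (hu a).pos
    exact abs_le.2 ⟨by linarith, by linarith⟩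
  have hmul : g a * divergence ε (u a) ≤ |g a - γ| * (∑ i, ε i + 2 * divergence ε (u a)) :=
    calc g a * divergence ε (u a) ≤ (g a - γ) * (∑ i, u a i - ∑ i, ε i) :=
          (hu a).mul_divergence_le hε hγ.le
      _ ≤ |g a - γ| * |∑ i, u a i - ∑ i, ε i| := (le_abs_self _).trans (abs_mul _ _).le
      _ ≤ |g a - γ| * (∑ i, ε i + 2 * divergence ε (u a)) := by gcongr
  rw [le_div_iff₀ ha]
  linarith

end Fit

section Rescale

variable {I : Type*} [DecidableEq I] {T : Finset I} {m : ℝ} {p x : I → ℝ}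

/-- The update made by IPF: the entries of `x` on `T` are multiplied by a common factor so that
their total becomes `m`. -/
def rescale (T : Finset I) (m : ℝ) (x : I → ℝ) (i : I) : ℝ :=
  if i ∈ T then x i * (m / ∑ k ∈ T, x k) else x i

lemma rescale_pos (hT : T.Nonempty) (hm : 0 < m) (hx : ∀ i, 0 < x i) (i : I) :
    0 < rescale T m x i := by
  have hc : 0 < ∑ k ∈ T, x k := Finset.sum_pos (fun k _ => hx k) hT
  unfold rescale
  split_ifs
  exacts [mul_pos (hx i) (div_pos hm hc), hx i]

lemma log_rescale (hT : T.Nonempty) (hm : 0 < m) (hx : ∀ i, 0 < x i) (i : I) :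
    Real.log (rescale T m x i) =
      Real.log (x i) + if i ∈ T then Real.log m - Real.log (∑ k ∈ T, x k) else 0 := by
  have hc : 0 < ∑ k ∈ T, x k := Finset.sum_pos (fun k _ => hx k) hT
  unfold rescale
  split_ifs
  · rw [Real.log_mul (hx i).ne' (div_pos hm hc).ne', Real.log_div hm.ne' hc.ne']
  · rw [add_zero]

lemma abs_rescale_sub_le (hx : ∀ i, 0 < x i) (i : I) :
    |rescale T m x i - x i| ≤ |∑ k ∈ T, x k - m| := by
  by_cases hi : i ∈ T
  · have hle : x i ≤ ∑ k ∈ T, x k := Finset.single_le_sum (fun k _ => (hx k).le) hi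
    have hc : 0 < ∑ k ∈ T, x k := (hx i).trans_le hle
    have hfactor : rescale T m x i - x i = x i / (∑ k ∈ T, x k) * (m - ∑ k ∈ T, x k) := by
      rw [rescale, if_pos hi]
      field_simp
    rw [hfactor, abs_mul, abs_of_pos (div_pos (hx i) hc), abs_sub_comm m]
    exact mul_le_of_le_one_left (abs_nonneg _) ((div_le_one hc).2 hle)
  · simp [rescale, hi]

/-- Pythagorean identity: `rescale T (∑ i ∈ T, p i) x` is the projection of `x` on the vectors that
have the same total over `T` as `p`. -/
theorem divergence_eq_divergence_rescale_add [Fintype I] (hT : T.Nonempty) (hp : ∀ i, 0 < p i)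
    (hx : ∀ i, 0 < x i) :
    divergence p x = divergence p (rescale T (∑ i ∈ T, p i) x) +
      poissonDivergence (∑ i ∈ T, p i) (∑ i ∈ T, x i) := by
  have hb : 0 < ∑ i ∈ T, p i := Finset.sum_pos (fun i _ => hp i) hT
  have hc : 0 < ∑ i ∈ T, x i := Finset.sum_pos (fun i _ => hx i) hT
  have hlog := log_rescale hT hb hx
  set b := ∑ i ∈ T, p i with hb_def
  set c := ∑ i ∈ T, x i with hc_def
  have hcell : ∀ i, poissonDivergence (p i) (x i) - poissonDivergence (p i) (rescale T b x i) =
      if i ∈ T then p i * (Real.log b - Real.log c) + x i * (1 - b / c) else 0 := fun i => by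
    rw [poissonDivergence, poissonDivergence, hlog i, rescale]
    split_ifs <;> ring
  rw [← sub_eq_iff_eq_add', divergence, divergence, ← Finset.sum_sub_distrib]
  simp only [hcell, Finset.sum_ite_mem, Finset.univ_inter, Finset.sum_add_distrib,
    ← Finset.sum_mul, ← hb_def, ← hc_def]
  rw [poissonDivergence, mul_one_sub, mul_div_cancel₀ b hc.ne', add_sub_assoc]

end Rescale

section ScalingSeq

variable {I : Type*} [DecidableEq I] {T : ℕ → Finset I} {p δ : I → ℝ} {x : ℕ → I → ℝ}

/-- Iterative scaling to the marginal totals of `p`: starting from a positive vector, step `d`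
makes the total over `T d` equal to that of `p`. -/
structure IsScalingSeq (T : ℕ → Finset I) (p : I → ℝ) (x : ℕ → I → ℝ) : Prop where
  pos_zero : ∀ i, 0 < x 0 i
  succ : ∀ d, x (d + 1) = rescale (T d) (∑ i ∈ T d, p i) (x d)

namespace IsScalingSeq

lemma congr (h : IsScalingSeq T p x) (hδ : ∀ d, ∑ i ∈ T d, δ i = ∑ i ∈ T d, p i) :
    IsScalingSeq T δ x :=
  ⟨h.pos_zero, fun d => by rw [hδ, h.succ]⟩

lemma pos (h : IsScalingSeq T p x) (hT : ∀ d, (T d).Nonempty) (hp : ∀ i, 0 < p i) (d : ℕ) :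
    ∀ i, 0 < x d i := by
  induction d with
  | zero => exact h.pos_zero
  | succ d ih =>
    rw [h.succ]
    exact rescale_pos (hT d) (Finset.sum_pos (fun i _ => hp i) (hT d)) ih

lemma divergence_sub_succ [Fintype I] (h : IsScalingSeq T p x) (hT : ∀ d, (T d).Nonempty)
    (hp : ∀ i, 0 < p i) (d : ℕ) : divergence p (x d) - divergence p (x (d + 1)) =
      poissonDivergence (∑ i ∈ T d, p i) (∑ i ∈ T d, x d i) := by
  rw [h.succ, divergence_eq_divergence_rescale_add (hT d) hp (h.pos hT hp d), add_sub_cancel_left]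

lemma antitone_divergence [Fintype I] (h : IsScalingSeq T p x) (hT : ∀ d, (T d).Nonempty)
    (hp : ∀ i, 0 < p i) : Antitone fun d => divergence p (x d) := by
  refine antitone_nat_of_succ_le fun d => sub_nonneg.1 ?_
  rw [h.divergence_sub_succ hT hp]
  exact poissonDivergence_nonneg (Finset.sum_pos (fun i _ => hp i) (hT d))
    (Finset.sum_pos (fun i _ => h.pos hT hp d i) (hT d))

variable [Finite I]

lemma tendsto_sum_sub_sum (h : IsScalingSeq T p x) (hT : ∀ d, (T d).Nonempty)
    (hp : ∀ i, 0 < p i) :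
    Tendsto (fun d => ∑ i ∈ T d, x d i - ∑ i ∈ T d, p i) atTop (𝓝 0) := by
  cases nonempty_fintype I
  refine tendsto_sub_of_tendsto_poissonDivergence (B := ∑ i, p i)
    (fun d => Finset.sum_pos (fun i _ => hp i) (hT d))
    (fun d => Finset.sum_le_univ_sum_of_nonneg fun i => (hp i).le)
    (fun d => Finset.sum_pos (fun i _ => h.pos hT hp d i) (hT d)) ?_
  have hlim := tendsto_atTop_ciInf (h.antitone_divergence hT hp)
    ⟨0, by rintro _ ⟨d, rfl⟩; exact divergence_nonneg hp (h.pos hT hp d)⟩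
  simpa [← h.divergence_sub_succ hT hp] using hlim.sub (hlim.comp (tendsto_add_atTop_nat 1))

lemma tendsto_shift_sub (h : IsScalingSeq T p x) (hT : ∀ d, (T d).Nonempty)
    (hp : ∀ i, 0 < p i) (n : ℕ) : Tendsto (fun d => x (d + n) - x d) atTop (𝓝 0) := by
  induction n with
  | zero => simp
  | succ n ih =>
    have hstep : Tendsto (fun d => x (d + 1) - x d) atTop (𝓝 0) := by
      refine tendsto_pi_nhds.2 fun i => squeeze_zero_norm (fun d => ?_)
        (tendsto_zero_iff_abs_tendsto_zero _ |>.1 (h.tendsto_sum_sub_sum hT hp))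
      rw [h.succ]
      exact abs_rescale_sub_le (h.pos hT hp d) i
    simpa [Function.comp_def, add_assoc] using (hstep.comp (tendsto_add_atTop_nat n)).add ih

lemma exists_pos_tendsto_subseq (h : IsScalingSeq T p x) (hT : ∀ d, (T d).Nonempty)
    (hp : ∀ i, 0 < p i) (k : ℕ → ℕ) : ∃ δ : I → ℝ, (∀ i, 0 < δ i) ∧
      ∃ φ : ℕ → ℕ, StrictMono φ ∧ Tendsto (fun d => x (k (φ d))) atTop (𝓝 δ) := by
  cases nonempty_fintype I
  obtain ⟨δ, hδ, φ, hφ, hlim⟩ := isCompact_Icc.tendsto_subseq fun d =>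
    mem_Icc_of_divergence_le hp (h.pos hT hp (k d)) (h.antitone_divergence hT hp (k d).zero_le)
  exact ⟨δ, fun i => (Real.exp_pos _).trans_le (hδ.1 i), φ, hφ, hlim⟩

/-- Along multiples of the period all iterates between two sweeps have the same cluster points, so
a cluster point `δ` has all the prescribed totals. It may then take the place of `p`: the
divergence from `δ` decreases, and it tends to zero along a subsequence. -/
theorem exists_tendsto_of_periodic (h : IsScalingSeq T p x) (hT : ∀ d, (T d).Nonempty)
    (hp : ∀ i, 0 < p i) {J : ℕ} (hJ : J ≠ 0) (hper : Function.Periodic T J) :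
    ∃ δ : I → ℝ, (∀ i, 0 < δ i) ∧ (∀ d, ∑ i ∈ T d, δ i = ∑ i ∈ T d, p i) ∧
      Tendsto x atTop (𝓝 δ) := by
  cases nonempty_fintype I
  obtain ⟨δ, hδ, φ, hφ, hlim⟩ := h.exists_pos_tendsto_subseq hT hp (fun d => d * J)
  have hsub : Tendsto (fun d => φ d * J) atTop atTop :=
    tendsto_atTop_mono (fun d => Nat.le_mul_of_pos_right _ (Nat.pos_of_ne_zero hJ)) hφ.tendsto_atTop
  have hshift : ∀ n, Tendsto (fun d => x (φ d * J + n)) atTop (𝓝 δ) := fun n => by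
    simpa [Function.comp_def] using ((h.tendsto_shift_sub hT hp n).comp hsub).add hlim
  have hTper : ∀ d n, T (φ d * J + n) = T n := fun d n => by
    rw [← hper.map_mod_nat, Nat.mul_add_mod', hper.map_mod_nat]
  have hsum : ∀ n, ∑ i ∈ T n, δ i = ∑ i ∈ T n, p i := fun n => by
    have hresidual : Tendsto (fun d => ∑ i ∈ T n, x (φ d * J + n) i - ∑ i ∈ T n, p i) atTop
        (𝓝 0) := by
      simpa only [Function.comp_def, hTper] using (h.tendsto_sum_sub_sum hT hp).comp
        ((tendsto_add_atTop_nat n).comp hsub)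
    have hsum_lim := tendsto_finsetSum (T n) fun i _ => tendsto_pi_nhds.1 (hshift n) i
    exact sub_eq_zero.1 (tendsto_nhds_unique (hsum_lim.sub_const _) hresidual)
  refine ⟨δ, hδ, hsum, tendsto_of_tendsto_divergence hδ (h.pos hT hp) ?_⟩
  have hanti : Antitone fun d => divergence δ (x d) := (h.congr hsum).antitone_divergence hT hδ
  exact (tendsto_iff_tendsto_subseq_of_antitone hanti hsub).2 (tendsto_divergence hδ hlim)

end IsScalingSeq

end ScalingSeq

section IPF

variable {I : Type*} {x : ℕ → I → ℝ} {halt : ℕ → Prop} {δ ε : I → ℝ}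

lemma iterationOutput_iff (hhalt : ∀ d, halt d → (∀ e < d, ¬ halt e) → x d = δ)
    (hlim : (∀ d, ¬ halt d) → Tendsto x atTop (𝓝 δ)) : IterationOutput x halt ε ↔ ε = δ := by
  constructor
  · rintro (⟨d, hd, hfirst, rfl⟩ | ⟨hnever, hε⟩)
    exacts [hhalt d hd hfirst, tendsto_nhds_unique hε (hlim hnever)]
  · rintro rfl
    by_cases hex : ∃ d, halt d
    · classical
      have hfirst : ∀ e < Nat.find hex, ¬ halt e := fun e he => Nat.find_min hex he
      exact Or.inl ⟨_, Nat.find_spec hex, hfirst, (hhalt _ (Nat.find_spec hex) hfirst).symm⟩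
    · exact Or.inr ⟨not_exists.1 hex, hlim (not_exists.1 hex)⟩

variable [Fintype I] [DecidableEq I] {J : ℕ} {S : Fin J → Finset I} {p q v : I → ℝ} {γ γ' : ℝ}
  {b : Fin J → ℝ}

lemma modelMatrix_mulVec (S : Fin J → Finset I) (v : I → ℝ) (j : Fin J) :
    (modelMatrix S *ᵥ v) j = ∑ i ∈ S j, v i := by
  simp [modelMatrix, Matrix.mulVec, dotProduct]

lemma modelMatrix_mulVec_pos (hS : ∀ j, (S j).Nonempty) (hv : ∀ i, 0 < v i) (j : Fin J) :
    0 < (modelMatrix S *ᵥ v) j := by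
  rw [modelMatrix_mulVec]
  exact Finset.sum_pos (fun i _ => hv i) (hS j)

lemma rescale_mem_relationalModel {j : Fin J} {m : ℝ} (hj : (S j).Nonempty) (hm : 0 < m)
    (hv : v ∈ relationalModel .poisson (modelMatrix S)) :
    rescale (S j) m v ∈ relationalModel .poisson (modelMatrix S) := by
  obtain ⟨hpos, β, hβ⟩ := hv
  refine ⟨rescale_pos hj hm hpos,
    β + Pi.single j (Real.log m - Real.log (∑ k ∈ S j, v k)), fun i => ?_⟩
  rw [log_rescale hj hm hpos, hβ, Matrix.mulVec_add, Pi.add_apply]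
  simp [modelMatrix]

variable [NeZero J]

lemma ipfSeq_succ (S : Fin J → Finset I) (q : I → ℝ) (γ : ℝ) (d : ℕ) :
    ipfSeq (modelMatrix S) q γ (d + 1) =
      rescale (S (Fin.ofNat J d)) (γ * (modelMatrix S *ᵥ q) (Fin.ofNat J d))
        (ipfSeq (modelMatrix S) q γ d) := by
  funext i
  change ipfSeq (modelMatrix S) q γ d i *
    (γ * (_ / _)) ^ (if i ∈ S (Fin.ofNat J d) then 1 else 0) = _
  rw [rescale, ← modelMatrix_mulVec]
  split_ifs
  · rw [Real.rpow_one, mul_div_assoc]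
  · rw [Real.rpow_zero, mul_one]

lemma isScalingSeq_ipfSeq (hp : modelMatrix S *ᵥ p = γ • modelMatrix S *ᵥ q) :
    IsScalingSeq (fun d => S (Fin.ofNat J d)) p (ipfSeq (modelMatrix S) q γ) where
  pos_zero _ := one_pos
  succ d := by rw [ipfSeq_succ, ← modelMatrix_mulVec, hp, Pi.smul_apply, smul_eq_mul]

lemma ipfSeq_mem_relationalModel (hS : ∀ j, (S j).Nonempty) (hp : ∀ i, 0 < p i)
    (h : modelMatrix S *ᵥ p = γ • modelMatrix S *ᵥ q) (d : ℕ) :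
    ipfSeq (modelMatrix S) q γ d ∈ relationalModel .poisson (modelMatrix S) := by
  induction d with
  | zero => exact ⟨fun _ => one_pos, 0, fun i => by simp [ipfSeq]⟩
  | succ d ih =>
    rw [(isScalingSeq_ipfSeq h).succ]
    exact rescale_mem_relationalModel (hS _) (Finset.sum_pos (fun i _ => hp i) (hS _)) ih

theorem exists_isFit_tendsto_ipfSeq (hS : ∀ j, (S j).Nonempty) (hp : ∀ i, 0 < p i)
    (h : modelMatrix S *ᵥ p = γ • modelMatrix S *ᵥ q) :
    ∃ δ, IsFit (modelMatrix S) (γ • modelMatrix S *ᵥ q) δ ∧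
      Tendsto (ipfSeq (modelMatrix S) q γ) atTop (𝓝 δ) := by
  have hperiodic : Function.Periodic (fun d => S (Fin.ofNat J d)) J := fun d =>
    congrArg S (Fin.ext (Nat.add_mod_right d J))
  obtain ⟨δ, hδ, hsum, hlim⟩ := (isScalingSeq_ipfSeq h).exists_tendsto_of_periodic
    (fun d => hS _) hp (NeZero.ne J) hperiodic
  refine ⟨δ, ⟨?_, ?_⟩, hlim⟩
  · exact mem_relationalModel_poisson_of_tendsto (ipfSeq_mem_relationalModel hS hp h) hδ hlim
  · funext j
    rw [← h, modelMatrix_mulVec, modelMatrix_mulVec]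
    simpa only [Fin.ofNat_val_eq_self] using hsum j

theorem IsFit.ipfOutput_iff (hS : ∀ j, (S j).Nonempty)
    (hδ : IsFit (modelMatrix S) (γ • modelMatrix S *ᵥ q) δ) :
    IPFOutput (modelMatrix S) q γ ε ↔ ε = δ := by
  obtain ⟨δ', hδ', hlim⟩ := exists_isFit_tendsto_ipfSeq hS hδ.pos hδ.mulVec_eq
  refine iterationOutput_iff (fun d hd _ => IsFit.eq ⟨?_, ?_⟩ hδ) fun _ => ?_
  · exact ipfSeq_mem_relationalModel hS hδ.pos hδ.mulVec_eq _
  · exact funext fun j => (hd j).symm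
  · exact hδ'.eq hδ ▸ hlim.comp (tendsto_add_atTop_nat 1)

theorem IsFit.exists_of_pos (hS : ∀ j, (S j).Nonempty) (hε : IsFit (modelMatrix S) (γ' • b) ε)
    (hγ' : 0 < γ') (hγ : 0 < γ) : ∃ δ, IsFit (modelMatrix S) (γ • b) δ := by
  have hfactor : γ • b = (γ / γ') • modelMatrix S *ᵥ ε := by
    rw [hε.mulVec_eq, smul_smul, div_mul_cancel₀ γ hγ'.ne']
  obtain ⟨δ, hδ, -⟩ := exists_isFit_tendsto_ipfSeq (p := (γ / γ') • ε) hS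
    (fun i => mul_pos (div_pos hγ hγ') (hε.pos i)) (Matrix.mulVec_smul _ _ _)
  exact ⟨δ, hfactor ▸ hδ⟩

end IPF

section LikelihoodEquations

variable {I : Type*} {J : ℕ} {A : Matrix (Fin J) I ℝ} {β : Fin J → ℝ}

/-- The cell parameters with coefficient vector `β`, that is, with `log δ = A' β`. These coordinates
on the relational model serve to differentiate the likelihood. -/
def cellParameters (A : Matrix (Fin J) I ℝ) (β : Fin J → ℝ) (i : I) : ℝ :=
  Real.exp ((Aᵀ *ᵥ β) i)

/-- The linear form `w ⬝ᵥ ·`, for `w` the gradient of a function of the coefficients. -/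
def dotProductCLM (w : Fin J → ℝ) : (Fin J → ℝ) →L[ℝ] ℝ :=
  (dotProductBilin ℝ ℝ w).toContinuousLinearMap

lemma dotProductCLM_apply (w v : Fin J → ℝ) : dotProductCLM w v = w ⬝ᵥ v :=
  rfl

lemma dotProductCLM_injective : Function.Injective (dotProductCLM (J := J)) := fun v w h =>
  dotProduct_eq v w fun u => DFunLike.congr_fun h u

variable [Fintype I] {s : Sampling} {y : I → ℕ} {δ : I → ℝ}

lemma mem_relationalModel_iff_exists_cellParameters : δ ∈ relationalModel s A ↔
    δ ∈ parameterSpace I s ∧ ∃ β, cellParameters A β = δ := by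
  refine and_congr_right fun hδ => exists_congr fun β => ?_
  have hpos : ∀ i, 0 < δ i := by
    cases s
    exacts [hδ, hδ.1]
  simp only [funext_iff, cellParameters]
  exact forall_congr' fun i => by rw [← Real.exp_eq_exp, Real.exp_log (hpos i), eq_comm]

lemma mulVec_dotProduct (A : Matrix (Fin J) I ℝ) (v : I → ℝ) (β : Fin J → ℝ) :
    A *ᵥ v ⬝ᵥ β = ∑ i, v i * (Aᵀ *ᵥ β) i := by
  rw [dotProduct_comm, Matrix.dotProduct_mulVec, ← Matrix.mulVec_transpose, dotProduct_comm]
  rfl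

lemma hasStrictFDerivAt_sum_cellParameters (A : Matrix (Fin J) I ℝ) (β : Fin J → ℝ) :
    HasStrictFDerivAt (fun β => ∑ i, cellParameters A β i)
      (dotProductCLM (A *ᵥ cellParameters A β)) β := by
  have hderiv := HasStrictFDerivAt.fun_sum (u := Finset.univ) (x := β) fun i _ =>
    (dotProductCLM (Aᵀ i)).hasStrictFDerivAt.exp
  refine hderiv.congr_fderiv (ContinuousLinearMap.ext fun v => ?_)
  rw [dotProductCLM_apply, mulVec_dotProduct]
  simp only [sum_apply, smul_apply]
  rfl

lemma prod_cellParameters_pow (A : Matrix (Fin J) I ℝ) (y : I → ℕ) (β : Fin J → ℝ) :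
    ∏ i, cellParameters A β i ^ y i = Real.exp (dotProductCLM (A *ᵥ fun i => (y i : ℝ)) β) := by
  simp only [dotProductCLM_apply, mulVec_dotProduct, cellParameters, Real.exp_sum,
    Real.exp_nat_mul]

lemma likelihood_poisson_cellParameters (A : Matrix (Fin J) I ℝ) (y : I → ℕ) (β : Fin J → ℝ) :
    likelihood .poisson y (cellParameters A β) = (∏ i, ((y i).factorial : ℝ))⁻¹ *
      Real.exp (dotProductCLM (A *ᵥ fun i => (y i : ℝ)) β - ∑ i, cellParameters A β i) := by
  rw [sub_eq_neg_add, Real.exp_add, ← prod_cellParameters_pow, ← Finset.sum_neg_distrib,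
    Real.exp_sum, likelihood, Finset.prod_div_distrib, Finset.prod_mul_distrib, inv_mul_eq_div]

theorem IsMLE.isFit_of_poisson (h : IsMLE .poisson A y δ) :
    IsFit A (A *ᵥ observed .poisson y) δ := by
  obtain ⟨-, β, rfl⟩ := mem_relationalModel_iff_exists_cellParameters.1 h.1
  have hmax : IsLocalMax (fun β' => dotProductCLM (A *ᵥ fun i => (y i : ℝ)) β' -
      ∑ i, cellParameters A β' i) β := by
    refine Eventually.of_forall fun β' => ?_
    have hle : likelihood .poisson y (cellParameters A β') ≤
        likelihood .poisson y (cellParameters A β) :=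
      h.2 (mem_relationalModel_iff_exists_cellParameters.2 ⟨fun i => Real.exp_pos _, β', rfl⟩)
    rw [likelihood_poisson_cellParameters, likelihood_poisson_cellParameters] at hle
    exact Real.exp_le_exp.1 (le_of_mul_le_mul_left hle (by positivity))
  have hgradient := hmax.hasFDerivAt_eq_zero ((dotProductCLM _).hasStrictFDerivAt.fun_sub
    (hasStrictFDerivAt_sum_cellParameters A β)).hasFDerivAt
  exact ⟨h.1, (dotProductCLM_injective (sub_eq_zero.1 hgradient)).symm⟩

theorem IsMLE.exists_multipliers (h : IsMLE .multinomial A y δ) :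
    ∃ a b : ℝ, (a, b) ≠ 0 ∧ a • (A *ᵥ δ) + b • (A *ᵥ fun i => (y i : ℝ)) = 0 := by
  obtain ⟨⟨-, hone⟩, β, rfl⟩ := mem_relationalModel_iff_exists_cellParameters.1 h.1
  have hmax : IsLocalExtrOn (dotProductCLM (A *ᵥ fun i => (y i : ℝ)))
      {β' | ∑ i, cellParameters A β' i = ∑ i, cellParameters A β i} β := by
    refine Or.inr (IsMaxOn.localize fun β' hβ' => ?_)
    have hle : likelihood .multinomial y (cellParameters A β') ≤
        likelihood .multinomial y (cellParameters A β) :=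
      h.2 (mem_relationalModel_iff_exists_cellParameters.2
        ⟨⟨fun i => Real.exp_pos _, hβ'.trans hone⟩, β', rfl⟩)
    simp only [likelihood, prod_cellParameters_pow] at hle
    exact Real.exp_le_exp.1 (le_of_mul_le_mul_left hle
      (Nat.cast_pos.2 (Nat.multinomial_pos _ _)))
  obtain ⟨a, b, hab, hgradient⟩ := hmax.exists_multipliers_of_hasStrictFDerivAt_1d
    (hasStrictFDerivAt_sum_cellParameters A β) (dotProductCLM _).hasStrictFDerivAt
  refine ⟨a, b, hab, dotProduct_eq _ _ fun v => ?_⟩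
  rw [add_dotProduct, smul_dotProduct, smul_dotProduct, zero_dotProduct]
  exact DFunLike.congr_fun hgradient v

variable [DecidableEq I] {S : Fin J → Finset I} {v : I → ℝ}

lemma sum_le_sum_modelMatrix_mulVec (hcover : ∀ i, ∃ j, i ∈ S j) (hv : ∀ i, 0 ≤ v i) :
    ∑ i, v i ≤ ∑ j, (modelMatrix S *ᵥ v) j := by
  choose c hc using hcover
  rw [← Finset.sum_fiberwise _ c]
  refine Finset.sum_le_sum fun j _ => ?_
  rw [modelMatrix_mulVec]
  exact Finset.sum_le_sum_of_subset_of_nonneg (fun i hi => (Finset.mem_filter.1 hi).2 ▸ hc i)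
    fun i _ _ => hv i

variable [NeZero J]

theorem exists_mem_of_mem_relationalModel (hS : ∀ j, (S j).Nonempty)
    (hδ : δ ∈ relationalModel .multinomial (modelMatrix S)) (i : I) : ∃ j, i ∈ S j := by
  obtain ⟨⟨hpos, hone⟩, β, hβ⟩ := hδ
  by_contra! hi
  have hlog : Real.log (δ i) = 0 := by
    rw [hβ]
    simp [Matrix.mulVec, dotProduct, modelMatrix, hi]
  obtain ⟨k, hk⟩ := hS 0
  have hlt : δ i < ∑ i, δ i := Finset.single_lt_sum (fun hki => hi 0 (hki ▸ hk))
    (Finset.mem_univ i) (Finset.mem_univ k) (hpos k) fun l _ _ => (hpos l).le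
  exact hlt.ne (hone ▸ Real.eq_one_of_pos_of_log_eq_zero (hpos i) hlog)

theorem IsMLE.exists_isFit_of_multinomial (hS : ∀ j, (S j).Nonempty) (hy : 0 < ∑ i, y i)
    (h : IsMLE .multinomial (modelMatrix S) y δ) : ∃ γ : ℝ, 0 < γ ∧
      IsFit (modelMatrix S) (γ • modelMatrix S *ᵥ observed .multinomial y) δ := by
  obtain ⟨a, b, hab, hmult⟩ := h.exists_multipliers
  set u := modelMatrix S *ᵥ δ
  set w := modelMatrix S *ᵥ fun i => (y i : ℝ)
  have hN : (0 : ℝ) < ∑ i, (y i : ℝ) := by exact_mod_cast hy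
  have hu : 0 < ∑ j, u j :=
    Finset.sum_pos (fun j _ => modelMatrix_mulVec_pos hS h.1.1.1 j) Finset.univ_nonempty
  have hw : 0 < ∑ j, w j := hN.trans_le <| sum_le_sum_modelMatrix_mulVec
    (exists_mem_of_mem_relationalModel hS h.1) fun i => Nat.cast_nonneg _
  have hmult_apply : ∀ j, a * u j + b * w j = 0 := congrFun hmult
  have hmult_sum : a * ∑ j, u j + b * ∑ j, w j = 0 := by
    rw [Finset.mul_sum, Finset.mul_sum, ← Finset.sum_add_distrib]
    exact Finset.sum_eq_zero fun j _ => hmult_apply j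
  have hb : b ≠ 0 := by
    rintro rfl
    exact hab (by simpa [hu.ne'] using hmult_sum)
  have hproportional : ∀ j, (∑ j, u j) * w j = (∑ j, w j) * u j := fun j =>
    mul_left_cancel₀ hb (by linear_combination (∑ j, u j) * hmult_apply j - u j * hmult_sum)
  have hobserved : (fun i => (y i : ℝ)) = (∑ i, (y i : ℝ)) • observed .multinomial y :=
    funext fun i => (mul_div_cancel₀ _ hN.ne').symm
  refine ⟨(∑ j, u j) / (∑ j, w j) * ∑ i, (y i : ℝ), by positivity, ⟨h.1.1.1, h.1.2⟩, ?_⟩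
  rw [mul_smul, ← Matrix.mulVec_smul, ← hobserved]
  funext j
  rw [Pi.smul_apply, smul_eq_mul, div_mul_eq_mul_div, hproportional, mul_div_cancel_left₀ _ hw.ne']

end LikelihoodEquations

section Bisection

variable {I : Type*} [Fintype I] {J : ℕ} [NeZero J] {A : Matrix (Fin J) I ℝ} {q : I → ℝ}
  {γL γR : ℕ → ℝ} {x : ℕ → I → ℝ}

lemma IsBisectionRun.right_sub_left (h : IsBisectionRun A q γL γR x) {k : ℕ}
    (hk : ∀ e < k, ∑ i, x e i ≠ 1) :
    γR k - γL k = (gammaRight A q - gammaLeft A q) / 2 ^ k := by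
  induction k with
  | zero => rw [h.left_zero, h.right_zero, pow_zero, div_one]
  | succ k ih =>
    have hle : ∀ e ≤ k, ∑ i, x e i ≠ 1 := fun e he => hk e (Nat.lt_succ_of_le he)
    rw [h.left_succ k hle, h.right_succ k hle, pow_succ, ← div_div,
      ← ih fun e he => hle e he.le]
    split_ifs <;> ring

/-- The successive intervals of the bisection in which IPF at `γ` has the output `g γ`. They show
that a run exists, and they go on even after a midpoint whose output has total one. -/
def bisectionInterval (A : Matrix (Fin J) I ℝ) (q : I → ℝ) (g : ℝ → I → ℝ) : ℕ → ℝ × ℝ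
  | 0 => (gammaLeft A q, gammaRight A q)
  | k + 1 =>
    let c := bisectionInterval A q g k
    if ∑ i, g ((c.1 + c.2) / 2) i < 1 then ((c.1 + c.2) / 2, c.2) else (c.1, (c.1 + c.2) / 2)

lemma bisectionInterval_pos {g : ℝ → I → ℝ} (hL : 0 < gammaLeft A q) (hR : 0 < gammaRight A q)
    (k : ℕ) : 0 < (bisectionInterval A q g k).1 ∧ 0 < (bisectionInterval A q g k).2 := by
  induction k with
  | zero => exact ⟨hL, hR⟩
  | succ k ih =>
    have hmid := half_pos (add_pos ih.1 ih.2)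
    simp only [bisectionInterval]
    split_ifs
    exacts [⟨hmid, ih.2⟩, ⟨ih.1, hmid⟩]

lemma isBisectionRun_bisectionInterval {g : ℝ → I → ℝ} (hL : 0 < gammaLeft A q)
    (hR : 0 < gammaRight A q) (hg : ∀ γ, 0 < γ → IPFOutput A q γ (g γ)) :
    IsBisectionRun A q (fun k => (bisectionInterval A q g k).1)
      (fun k => (bisectionInterval A q g k).2)
      fun k => g (((bisectionInterval A q g k).1 + (bisectionInterval A q g k).2) / 2) where
  left_zero := rfl
  right_zero := rfl
  ipf k _ := hg _ (half_pos (add_pos (bisectionInterval_pos hL hR k).1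
    (bisectionInterval_pos hL hR k).2))
  left_succ _ _ := apply_ite Prod.fst _ _ _
  right_succ _ _ := apply_ite Prod.snd _ _ _

variable [DecidableEq I] {S : Fin J → Finset I} {δ ε : I → ℝ} {γ γ' : ℝ}

lemma IsFit.gammaLeft_mem_Ioc (hS : ∀ j, (S j).Nonempty)
    (hε : IsFit (modelMatrix S) (γ • modelMatrix S *ᵥ q) ε) (hsum : ∑ i, ε i = 1) (hγ : 0 < γ) :
    gammaLeft (modelMatrix S) q ∈ Set.Ioc 0 γ := by
  have hcover := exists_mem_of_mem_relationalModel hS ⟨⟨hε.pos, hsum⟩, hε.mem.2⟩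
  have hone : 1 ≤ γ * ∑ j, (modelMatrix S *ᵥ q) j := by
    simpa [hε.mulVec_eq, Finset.mul_sum, hsum] using
      sum_le_sum_modelMatrix_mulVec hcover fun i => (hε.pos i).le
  have hpos : 0 < ∑ j, (modelMatrix S *ᵥ q) j :=
    pos_of_mul_pos_right (one_pos.trans_le hone) hγ.le
  exact ⟨inv_pos.2 hpos, (inv_le_iff_one_le_mul₀ hpos).2 hone⟩

lemma IsFit.le_gammaRight (hS : ∀ j, (S j).Nonempty)
    (hε : IsFit (modelMatrix S) (γ • modelMatrix S *ᵥ q) ε) (hsum : ∑ i, ε i = 1) (hγ : 0 < γ) :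
    γ ≤ gammaRight (modelMatrix S) q := by
  refine Finset.le_inf' _ _ fun j _ => ?_
  have hj : (modelMatrix S *ᵥ ε) j = γ * (modelMatrix S *ᵥ q) j := congrFun hε.mulVec_eq j
  have hpos := modelMatrix_mulVec_pos hS hε.pos j
  have hone : (modelMatrix S *ᵥ ε) j ≤ 1 := by
    rw [modelMatrix_mulVec, ← hsum]
    exact Finset.sum_le_univ_sum_of_nonneg fun i => (hε.pos i).le
  rw [hj] at hpos hone
  exact (le_div_iff₀ (pos_of_mul_pos_right hpos hγ.le)).2 hone

lemma IsFit.isFit_of_ipfOutput (hS : ∀ j, (S j).Nonempty)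
    (hε : IsFit (modelMatrix S) (γ' • modelMatrix S *ᵥ q) ε) (hγ' : 0 < γ') (hγ : 0 < γ)
    (hδ : IPFOutput (modelMatrix S) q γ δ) :
    IsFit (modelMatrix S) (γ • modelMatrix S *ᵥ q) δ := by
  obtain ⟨δ', hδ'⟩ := hε.exists_of_pos hS hγ' hγ
  rwa [(hδ'.ipfOutput_iff hS).1 hδ]

namespace IsBisectionRun

variable (h : IsBisectionRun (modelMatrix S) q γL γR x) (hS : ∀ j, (S j).Nonempty)
  (hε : IsFit (modelMatrix S) (γ • modelMatrix S *ᵥ q) ε) (hsum : ∑ i, ε i = 1) (hγ : 0 < γ)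
include h hS hε hsum hγ

theorem left_pos_and_mem_Icc {k : ℕ} (hk : ∀ e < k, ∑ i, x e i ≠ 1) :
    0 < γL k ∧ γ ∈ Set.Icc (γL k) (γR k) := by
  induction k with
  | zero =>
    have hL := hε.gammaLeft_mem_Ioc hS hsum hγ
    rw [h.left_zero, h.right_zero]
    exact ⟨hL.1, hL.2, hε.le_gammaRight hS hsum hγ⟩
  | succ k ih =>
    have hle : ∀ e ≤ k, ∑ i, x e i ≠ 1 := fun e he => hk e (Nat.lt_succ_of_le he)
    obtain ⟨hpos, hL, hR⟩ := ih fun e he => hle e he.le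
    have hmid : 0 < (γL k + γR k) / 2 := by linarith
    have hx := hε.isFit_of_ipfOutput hS hγ hmid (h.ipf k fun e he => hle e he.le)
    rw [h.left_succ k hle, h.right_succ k hle]
    split_ifs with hlt
    · exact ⟨hmid, hx.le_of_sum_lt_sum hε hmid.le hγ.le (hsum ▸ hlt), hR⟩
    · have hgt : 1 < ∑ i, x k i := (not_lt.1 hlt).lt_of_ne' (hle k le_rfl)
      exact ⟨hpos, hL, hε.le_of_sum_lt_sum hx hγ.le hmid.le (hsum ▸ hgt)⟩

lemma midpoint_pos {k : ℕ} (hk : ∀ e < k, ∑ i, x e i ≠ 1) : 0 < (γL k + γR k) / 2 := by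
  obtain ⟨hpos, -, hR⟩ := h.left_pos_and_mem_Icc hS hε hsum hγ hk
  linarith

lemma isFit {k : ℕ} (hk : ∀ e < k, ∑ i, x e i ≠ 1) :
    IsFit (modelMatrix S) (((γL k + γR k) / 2) • modelMatrix S *ᵥ q) (x k) :=
  hε.isFit_of_ipfOutput hS hγ (h.midpoint_pos hS hε hsum hγ hk) (h.ipf k hk)

lemma tendsto_midpoint (hne : ∀ k, ∑ i, x k i ≠ 1) :
    Tendsto (fun k => (γL k + γR k) / 2) atTop (𝓝 γ) := by
  have hwidth : Tendsto (fun k => γR k - γL k) atTop (𝓝 0) := by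
    simp only [fun k => h.right_sub_left fun e (_ : e < k) => hne e]
    exact tendsto_const_nhds.div_atTop (tendsto_pow_atTop_atTop_of_one_lt one_lt_two)
  refine tendsto_iff_norm_sub_tendsto_zero.2
    (squeeze_zero (fun k => norm_nonneg _) (fun k => ?_) hwidth)
  obtain ⟨-, hL, hR⟩ := h.left_pos_and_mem_Icc hS hε hsum hγ fun e (_ : e < k) => hne e
  exact abs_le.2 ⟨by linarith, by linarith⟩

theorem iterationOutput_iff : IterationOutput x (fun k => ∑ i, x k i = 1) δ ↔ δ = ε := by
  have hx := fun k => h.isFit hS hε hsum hγ (k := k)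
  refine RelationalModel.iterationOutput_iff (fun k hone hk => ?_) fun hne => ?_
  · exact (hx k hk).eq_of_sum_eq hε (h.midpoint_pos hS hε hsum hγ hk) hγ.le
      (hone.trans hsum.symm)
  · exact IsFit.tendsto (fun k => hx k fun e _ => hne e) hε hγ
      (h.tendsto_midpoint hS hε hsum hγ hne)

end IsBisectionRun

theorem IsFit.bisectionOutput_iff (hS : ∀ j, (S j).Nonempty)
    (hε : IsFit (modelMatrix S) (γ • modelMatrix S *ᵥ q) ε) (hsum : ∑ i, ε i = 1)
    (hγ : 0 < γ) : BisectionOutput (modelMatrix S) q δ ↔ δ = ε := by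
  constructor
  · rintro ⟨γL, γR, x, hrun, hout⟩
    exact (hrun.iterationOutput_iff hS hε hsum hγ).1 hout
  · intro hδ
    choose! g hg using fun γ' (hγ' : 0 < γ') => hε.exists_of_pos hS hγ hγ'
    have hrun := isBisectionRun_bisectionInterval (hε.gammaLeft_mem_Ioc hS hsum hγ).1
      (hγ.trans_le (hε.le_gammaRight hS hsum hγ)) fun γ' hγ' =>
        ((hg γ' hγ').ipfOutput_iff hS).2 rfl
    exact ⟨_, _, _, hrun, (hrun.iterationOutput_iff hS hε hsum hγ).2 hδ⟩

end Bisection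

section GIPF

variable {I : Type*} [Fintype I] [DecidableEq I] {J : ℕ} [NeZero J] {S : Fin J → Finset I}
  {y : I → ℕ} {δ ε : I → ℝ}

theorem IsMLE.gipfOutput_iff_of_poisson (hS : ∀ j, (S j).Nonempty)
    (h : IsMLE .poisson (modelMatrix S) y ε) :
    GIPFOutput .poisson (modelMatrix S) (observed .poisson y) δ ↔ δ = ε := by
  have hfit := h.isFit_of_poisson
  rw [← one_smul ℝ (modelMatrix S *ᵥ observed .poisson y)] at hfit
  exact hfit.ipfOutput_iff hS

theorem IsMLE.gipfOutput_iff_of_multinomial (hS : ∀ j, (S j).Nonempty) (hy : 0 < ∑ i, y i)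
    (h : IsMLE .multinomial (modelMatrix S) y ε) :
    GIPFOutput .multinomial (modelMatrix S) (observed .multinomial y) δ ↔ δ = ε := by
  obtain ⟨γ, hγ, hfit⟩ := h.exists_isFit_of_multinomial hS hy
  have hsum : ∑ i, ε i = 1 := h.1.1.2
  obtain ⟨p, hp⟩ := hfit.exists_of_pos hS hγ one_pos
  simp only [GIPFOutput, hp.ipfOutput_iff hS, exists_eq_left,
    hfit.bisectionOutput_iff hS hsum hγ]
  by_cases hone : ∑ i, p i = 1
  · simp [hp.eq_of_sum_eq hfit one_pos hγ.le (hone.trans hsum.symm), hsum]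
  · simp [hone]

end GIPF

end RelationalModel

end

/-- If the maximum likelihood estimate under the relational model generated by the non-empty
subsets `S 0, …, S (J - 1)` exists and is unique, then G-IPF has exactly one output, and this
output is the maximum likelihood estimate. -/
theorem mainTheorem1 {I : Type*} [Fintype I] [DecidableEq I] (J : ℕ) [NeZero J]
    (S : Fin J → Finset I) (hS : ∀ j, (S j).Nonempty)
    (s : RelationalModel.Sampling) (y : I → ℕ)
    (hy : s = RelationalModel.Sampling.multinomial → 0 < ∑ i, y i)
    (hMLE : ∃! δ : I → ℝ, RelationalModel.IsMLE s (RelationalModel.modelMatrix S) y δ) :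
    ∃ δhat : I → ℝ,
      RelationalModel.IsMLE s (RelationalModel.modelMatrix S) y δhat ∧
      ∀ δ : I → ℝ,
        RelationalModel.GIPFOutput s (RelationalModel.modelMatrix S)
          (RelationalModel.observed s y) δ ↔ δ = δhat := by
  obtain ⟨ε, hε, -⟩ := hMLE
  refine ⟨ε, hε, fun δ => ?_⟩
  cases s with
  | poisson => exact hε.gipfOutput_iff_of_poisson hS
  | multinomial => exact hε.gipfOutput_iff_of_multinomial hS (hy rfl)
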